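/- Let $E$ be a complex Banach space and $a\in\mathbb R$. A local operator is a formal series $P(d/dt)=\sum_{k\ge 0}b_k(d/dt)^k$ with $b_k\in\mathbb C$ and $\lim_{k\to\infty}(|b_k|\,k!)^{1/k}=0$; its symbol is the entire function $P(\lambda)=\sum_{k\ge0}b_k\lambda^k$. Let $f:\{\lambda\in\mathbb C:\operatorname{Re}\lambda>a\}\to E$ be analytic with $\|f(\lambda)\|\le C|P(\lambda)|$ for $\operatorname{Re}\lambda>a$, where $C>0$ and $P$ is a local operator with $|P(\lambda)|>0$ for $\operatorname{Re}\lambda>a$. Let $\tilde P$ be a local operator such that $$C_1\,e^{A|\lambda|/r(|\lambda|+1)}\le|\tilde P(\lambda)|,\qquad \operatorname{Re}\lambda>a,$$ for some $C_1,A>0$ and some monotone increasing function $r:[0,\infty)\to\mathbb R$ with $r(0)=1$ and $r(s)\to\infty$ as $s\to\infty$, where $\log s=o\big(s/r(s+1)\big)$ as $s\to\infty$ (that is, the lower bound grows faster than every power of $|\lambda|$). Then there exist $M>0$ and $h\in C^\infty([0,\infty);E)$ with $h^{(j)}(0)=0$ for all $j\in\mathbb N_0$ and $\|h(t)\|\le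 Me^{at}$ for all $t\ge0$, such that $$f(\lambda)=P(\lambda)\tilde P(\lambda)\int_0^\infty e^{-\lambda t}h(t)\,dt,\qquad \operatorname{Re}\lambda>a,$$ the integral being absolutely convergent. -/

import Mathlib

open Filter Set MeasureTheory Topology Asymptotics
open scoped ContDiff Nat

/-- The coefficients `b k` (complex numbers) define a local operator
`P(d/dt) = ∑ b k (d/dt)^k`: one has `(|b k| k!)^(1/k) → 0` as `k → ∞`. -/
def IsLocalOperator (b : ℕ → ℂ) : Prop :=
  Tendsto (fun k : ℕ => (‖b k‖ * (k ! : ℝ)) ^ ((1 : ℝ) / (k : ℝ))) atTop (𝓝 0)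

/-- The symbol `P(z) = ∑ b k z^k` of the operator `∑ b k (d/dt)^k`.
For a local operator the series converges for every `z`, see `IsLocalOperator.summable`. -/
noncomputable def symbol (b : ℕ → ℂ) (z : ℂ) : ℂ := ∑' k : ℕ, b k * z ^ k

/-- The symbol series of a local operator converges absolutely everywhere, so that the `tsum`
in `symbol` is a genuine sum. -/
theorem IsLocalOperator.summable {b : ℕ → ℂ} (hb : IsLocalOperator b) (z : ℂ) :
    Summable (fun k : ℕ => b k * z ^ k) := by
  have h1 : ∀ᶠ k : ℕ in atTop, ‖b k * z ^ k‖ ≤ ‖z‖ ^ k / (k ! : ℝ) := by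
    filter_upwards [hb.eventually (gt_mem_nhds (zero_lt_one)), eventually_gt_atTop 0]
      with k hk hk0
    have hf : (0 : ℝ) < (k ! : ℝ) := by exact_mod_cast Nat.factorial_pos k
    have h2 : ‖b k‖ * (k ! : ℝ) ≤ 1 := by
      by_contra! hcon
      have h3 := Real.one_lt_rpow hcon (z := (1 : ℝ) / (k : ℝ)) (by positivity)
      linarith
    rw [norm_mul, norm_pow, le_div_iff₀ hf]
    nlinarith [pow_nonneg (norm_nonneg z) k]
  exact Summable.of_norm_bounded_eventually_nat (Real.summable_pow_div_factorial ‖z‖) h1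

/-- The lower bound `C exp (A |z| / r (|z| + 1)) ≤ |P(z)|` on the half-plane `a < Re z`, for some
`C, A > 0` and some monotone increasing `r` on `[0, ∞)` with `r 0 = 1` and `r s → ∞`, where
`log s = o (s / r (s + 1))`, i.e. the left-hand side grows faster than every power of `|z|`. -/
def HasExpLowerBound (b : ℕ → ℂ) (a : ℝ) : Prop :=
  ∃ C : ℝ, 0 < C ∧ ∃ A : ℝ, 0 < A ∧ ∃ r : ℝ → ℝ,
    MonotoneOn r (Ici 0) ∧ r 0 = 1 ∧ Tendsto r atTop atTop ∧
    (fun s : ℝ => Real.log s) =o[atTop] (fun s : ℝ => s / r (s + 1)) ∧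
    ∀ z : ℂ, a < z.re → C * Real.exp (A * ‖z‖ / r (‖z‖ + 1)) ≤ ‖symbol b z‖

/-! The function `h` is the inverse Laplace transform of `g = f / (P P̃)`. Since `f / P` is bounded
and `1 / P̃` decays faster than every power of `|z|`, `g` is holomorphic and rapidly decaying on the
whole half-plane, uniformly up to its edge. Cauchy's theorem makes the inversion integral
independent of the line `Re z = c > a` (`inverseLaplace_eq`), and it is bounded by `M exp (c t)`
with `M` independent of `c`. Letting `c → a` gives the growth bound; letting `c → ∞` for `t < 0`
gives `h = 0` there. As `h` is smooth on `ℝ`, all its derivatives vanish at `0`. Fourier inversion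
on the line through `z` then recovers `g z` (`integral_exp_smul_inverseLaplace`). -/

/-- The symbol of a local operator is an entire function. -/
theorem IsLocalOperator.differentiable_symbol {b : ℕ → ℂ} (hb : IsLocalOperator b) :
    Differentiable ℂ (symbol b) := by
  intro z
  have hz : z ∈ Metric.ball (0 : ℂ) (‖z‖ + 1) := by simp
  have h := Complex.differentiableOn_tsum_of_summable_norm
    (F := fun k (w : ℂ) => b k * w ^ k) (U := Metric.ball 0 (‖z‖ + 1))
    (hb.summable ((‖z‖ + 1 : ℝ) : ℂ)).norm (fun k => by fun_prop) Metric.isOpen_ball ?_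
  · exact h.differentiableAt (Metric.isOpen_ball.mem_nhds hz)
  · intro k w hw
    have hw' : ‖w‖ ≤ ‖z‖ + 1 := (mem_ball_zero_iff.1 hw).le
    rw [norm_mul, norm_mul, norm_pow, norm_pow, Complex.norm_real, Real.norm_of_nonneg (by positivity)]
    gcongr

/-- If `log s = o (ψ s)`, then `exp (-A ψ)` decays faster than every power. -/
theorem exists_one_add_pow_mul_exp_neg_le {ψ : ℝ → ℝ} {A : ℝ} (hA : 0 < A)
    (hψ : Real.log =o[atTop] ψ) (hψ0 : ∀ s, 0 ≤ s → 0 ≤ ψ s) (n : ℕ) :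
    ∃ K : ℝ, 0 ≤ K ∧ ∀ s : ℝ, 0 ≤ s → (1 + s) ^ n * Real.exp (-(A * ψ s)) ≤ K := by
  -- With this little-o constant, `n log s ≤ A ψ s` for large `s`; `n + 1` avoids division by zero
  -- at `n = 0`.
  have hpos : 0 < A / (n + 1) := by positivity
  obtain ⟨S, hS⟩ := eventually_atTop.1 ((hψ.def hpos).and (eventually_ge_atTop 1))
  set T := max S 1
  refine ⟨(1 + T) ^ n + 2 ^ n, by positivity, fun s hs => ?_⟩
  have hexp : Real.exp (-(A * ψ s)) ≤ 1 :=
    Real.exp_le_one_iff.2 (by have := mul_nonneg hA.le (hψ0 s hs); linarith)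
  rcases le_total s T with hsT | hsT
  · calc (1 + s) ^ n * Real.exp (-(A * ψ s)) ≤ (1 + T) ^ n * 1 := by gcongr
      _ ≤ _ := by have : (0 : ℝ) ≤ 2 ^ n := by positivity
                  linarith
  · have hs1 : 1 ≤ s := (le_max_right _ _).trans hsT
    have hs0 : 0 < s := by linarith
    have h := (hS s ((le_max_left _ _).trans hsT)).1
    rw [Real.norm_of_nonneg (Real.log_nonneg hs1), Real.norm_of_nonneg (hψ0 s hs),
      div_mul_eq_mul_div, le_div_iff₀ (by positivity)] at h
    have hlog : n * Real.log s ≤ A * ψ s := by nlinarith [Real.log_nonneg hs1]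
    have hpow : s ^ n ≤ Real.exp (A * ψ s) := by
      rw [← Real.exp_log (pow_pos hs0 n), Real.log_pow]
      exact Real.exp_le_exp.2 hlog
    calc (1 + s) ^ n * Real.exp (-(A * ψ s)) ≤ (2 * s) ^ n * Real.exp (-(A * ψ s)) := by
          gcongr; linarith
      _ = 2 ^ n * (s ^ n * Real.exp (-(A * ψ s))) := by ring
      _ ≤ 2 ^ n * (Real.exp (A * ψ s) * Real.exp (-(A * ψ s))) := by gcongr
      _ = 2 ^ n := by rw [← Real.exp_add]; simp
      _ ≤ _ := by have : 0 ≤ (1 + T) ^ n := by positivity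
                  linarith

/-! ### Inverse Laplace transform of rapidly decaying holomorphic functions -/

section InverseLaplace

variable {E : Type*} [NormedAddCommGroup E] [NormedSpace ℂ E]

/-- Shifting the line of integration of a holomorphic function that decays in a vertical strip. -/
theorem integral_vertical_line_eq [CompleteSpace E] {F : ℂ → E} {c d K : ℝ} (hcd : c ≤ d)
    (hF : DifferentiableOn ℂ F {z | z.re ∈ Icc c d})
    (hK : ∀ z : ℂ, z.re ∈ Icc c d → ‖F z‖ ≤ K * (1 + z.im ^ 2)⁻¹) :
    ∫ y : ℝ, F (c + y * Complex.I) = ∫ y : ℝ, F (d + y * Complex.I) := by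
  have hint : ∀ x ∈ Icc c d, Integrable fun y : ℝ => F (x + y * Complex.I) := by
    intro x hx
    refine (integrable_inv_one_add_sq.const_mul K).mono' ?_ (.of_forall fun y => ?_)
    · refine (hF.continuousOn.comp_continuous (by fun_prop) fun y => ?_).aestronglyMeasurable
      simpa using hx
    · simpa using hK (x + y * Complex.I) (by simpa using hx)
  -- Taking `u T = T` and `u T = -T` treats both horizontal sides of the rectangle at once.
  have hhor : ∀ u : ℝ → ℝ, (∀ T, u T ^ 2 = T ^ 2) →
      Tendsto (fun T => ∫ x in c..d, F (x + u T * Complex.I)) atTop (𝓝 0) := by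
    intro u hu
    refine squeeze_zero_norm (a := fun T => K * (1 + T ^ 2)⁻¹ * |d - c|) (fun T => ?_) ?_
    · refine intervalIntegral.norm_integral_le_of_norm_le_const fun x hx => ?_
      rw [uIoc_of_le hcd] at hx
      simpa [hu] using hK (x + u T * Complex.I) (by simpa using ⟨hx.1.le, hx.2⟩)
    · have h1 : Tendsto (fun T : ℝ => (1 + T ^ 2)⁻¹) atTop (𝓝 0) :=
        (tendsto_atTop_add_const_left _ _ (tendsto_pow_atTop two_ne_zero)).inv_tendsto_atTop
      simpa using (h1.const_mul K).mul_const |d - c|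
  have hver : ∀ x ∈ Icc c d, Tendsto (fun T : ℝ => ∫ y in (-T)..T, F (x + y * Complex.I)) atTop
      (𝓝 (∫ y : ℝ, F (x + y * Complex.I))) := fun x hx =>
    intervalIntegral_tendsto_integral (hint x hx) tendsto_neg_atTop_atBot tendsto_id
  have hrect : ∀ T : ℝ, (∫ x in c..d, F (x + (-T : ℝ) * Complex.I)) -
      (∫ x in c..d, F (x + T * Complex.I)) + Complex.I • (∫ y in (-T)..T, F (d + y * Complex.I)) -
      Complex.I • (∫ y in (-T)..T, F (c + y * Complex.I)) = 0 := by
    intro T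
    have := Complex.integral_boundary_rect_eq_zero_of_differentiableOn F
      (c + (-T : ℝ) * Complex.I) (d + T * Complex.I) (hF.mono ?_)
    · simpa using this
    · intro z hz
      have := hz.1
      simpa [uIcc_of_le hcd] using this
  have hlim := (((hhor (fun T => -T) (by simp)).sub (hhor id (by simp))).add
    ((hver d (right_mem_Icc.2 hcd)).const_smul Complex.I)).sub
    ((hver c (left_mem_Icc.2 hcd)).const_smul Complex.I)
  have h0 := tendsto_nhds_unique (hlim.congr hrect) tendsto_const_nhds
  rw [sub_self, zero_add, ← smul_sub, smul_eq_zero, sub_eq_zero] at h0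
  exact (h0.resolve_left Complex.I_ne_zero).symm

/-- The inverse Laplace integral of `g` along the line `Re z = c`, evaluated at `t`. -/
noncomputable def inverseLaplace (g : ℂ → E) (c t : ℝ) : E :=
  (2 * Real.pi)⁻¹ • ∫ y : ℝ, Complex.exp ((c + y * Complex.I) * t) • g (c + y * Complex.I)

theorem inverseLaplace_eq_fourierInv (g : ℂ → E) (c t : ℝ) :
    inverseLaplace g c t = Complex.exp (c * t) •
      FourierTransform.fourierInv
        (fun v : ℝ => g (c + (2 * Real.pi * v : ℝ) * Complex.I)) t := by
  have h := Measure.integral_comp_mul_left (fun y : ℝ =>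
    Complex.exp ((c + y * Complex.I) * t) • g (c + y * Complex.I)) (2 * Real.pi)
  rw [abs_of_nonneg (by positivity)] at h
  rw [inverseLaplace, ← h, Real.fourierInv_eq', ← integral_smul]
  congr 1 with v
  rw [smul_smul, ← Complex.exp_add]
  congr 2
  simp
  ring

/-- `g` is holomorphic on `Re z > a` and decays there faster than every power of `‖z‖`. -/
structure RapidDecayHalfPlane (g : ℂ → E) (a : ℝ) : Prop where
  differentiableOn : DifferentiableOn ℂ g {z | a < z.re}
  decay : ∀ n : ℕ, ∃ K : ℝ, 0 ≤ K ∧ ∀ z : ℂ, a < z.re → (1 + ‖z‖) ^ n * ‖g z‖ ≤ K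

namespace RapidDecayHalfPlane

variable {g : ℂ → E} {a : ℝ}

/-- Two spare powers of decay buy an integrable majorant that is the same on every vertical line. -/
theorem exists_pow_mul_norm_le (hg : RapidDecayHalfPlane g a) (n : ℕ) :
    ∃ K : ℝ, 0 ≤ K ∧ ∀ z : ℂ, a < z.re → |z.im| ^ n * ‖g z‖ ≤ K * (1 + z.im ^ 2)⁻¹ := by
  obtain ⟨K, hK0, hK⟩ := hg.decay (n + 2)
  refine ⟨K, hK0, fun z hz => ?_⟩
  rw [← div_eq_mul_inv, le_div_iff₀ (by positivity)]
  refine le_trans ?_ (hK z hz)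
  have him := Complex.abs_im_le_norm z
  have h1 : |z.im| ^ n ≤ (1 + ‖z‖) ^ n := by gcongr; linarith
  have h2 : 1 + z.im ^ 2 ≤ (1 + ‖z‖) ^ 2 := by
    rw [← sq_abs z.im]; nlinarith [abs_nonneg z.im]
  calc |z.im| ^ n * ‖g z‖ * (1 + z.im ^ 2) = |z.im| ^ n * (1 + z.im ^ 2) * ‖g z‖ := by ring
    _ ≤ (1 + ‖z‖) ^ n * (1 + ‖z‖) ^ 2 * ‖g z‖ := by gcongr
    _ = _ := by ring

theorem continuous_line (hg : RapidDecayHalfPlane g a) {c : ℝ} (hc : a < c) :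
    Continuous fun v : ℝ => g (c + (2 * Real.pi * v : ℝ) * Complex.I) :=
  hg.differentiableOn.continuousOn.comp_continuous (by fun_prop) fun v => by simpa using hc

theorem integrable_pow_mul_norm_line (hg : RapidDecayHalfPlane g a) {c : ℝ} (hc : a < c) (n : ℕ) :
    Integrable fun v : ℝ => ‖v‖ ^ n * ‖g (c + (2 * Real.pi * v : ℝ) * Complex.I)‖ := by
  obtain ⟨K, hK0, hK⟩ := hg.exists_pow_mul_norm_le n
  refine (integrable_inv_one_add_sq.const_mul K).mono'
    ((by fun_prop : Continuous fun v : ℝ => ‖v‖ ^ n).mul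
      (hg.continuous_line hc).norm).aestronglyMeasurable (.of_forall fun v => ?_)
  have h := hK (c + (2 * Real.pi * v : ℝ) * Complex.I) (by simpa using hc)
  have him : ((c : ℂ) + (2 * Real.pi * v : ℝ) * Complex.I).im = 2 * Real.pi * v := by simp
  have hv : |v| ≤ |2 * Real.pi * v| := by
    rw [abs_mul, abs_of_nonneg (by positivity : 0 ≤ 2 * Real.pi)]
    nlinarith [abs_nonneg v, Real.pi_gt_three]
  rw [him] at h
  rw [Real.norm_of_nonneg (by positivity), Real.norm_eq_abs]
  calc _ ≤ |2 * Real.pi * v| ^ n * ‖g (c + (2 * Real.pi * v : ℝ) * Complex.I)‖ := by gcongr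
    _ ≤ _ := h
    _ ≤ _ := by
      gcongr K * (1 + ?_)⁻¹
      exact sq_le_sq.2 hv

theorem integrable_line (hg : RapidDecayHalfPlane g a) {c : ℝ} (hc : a < c) :
    Integrable fun v : ℝ => g (c + (2 * Real.pi * v : ℝ) * Complex.I) := by
  rw [← integrable_norm_iff (hg.continuous_line hc).aestronglyMeasurable]
  simpa using hg.integrable_pow_mul_norm_line hc 0

/-- All moments of `g` along the line are finite, so its Fourier transform is smooth. -/
theorem contDiff_inverseLaplace (hg : RapidDecayHalfPlane g a) {c : ℝ} (hc : a < c) :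
    ContDiff ℝ ∞ (inverseLaplace g c) := by
  have h := Real.contDiff_fourier (N := ⊤)
    (f := fun v : ℝ => g (c + (2 * Real.pi * v : ℝ) * Complex.I))
    fun n _ => hg.integrable_pow_mul_norm_line hc n
  have h2 : inverseLaplace g c = fun t : ℝ => Complex.exp (c * t) •
      FourierTransform.fourier
        (fun v : ℝ => g (c + (2 * Real.pi * v : ℝ) * Complex.I)) (-t) := by
    ext t
    rw [inverseLaplace_eq_fourierInv, Real.fourierInv_eq_fourier_neg]
  rw [h2]
  refine ContDiff.smul ?_ (h.comp contDiff_neg)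
  exact (contDiff_const.mul Complex.ofRealCLM.contDiff).cexp

theorem exists_norm_inverseLaplace_le (hg : RapidDecayHalfPlane g a) :
    ∃ M : ℝ, 0 < M ∧ ∀ c t : ℝ, a < c → ‖inverseLaplace g c t‖ ≤ M * Real.exp (c * t) := by
  obtain ⟨K, hK0, hK⟩ := hg.exists_pow_mul_norm_le 0
  set J := (2 * Real.pi)⁻¹ * ∫ y : ℝ, K * (1 + y ^ 2)⁻¹
  have hJ : 0 ≤ J := mul_nonneg (by positivity) (integral_nonneg fun y => by positivity)
  -- `J` may be zero, while `M` must be positive.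
  refine ⟨J + 1, by positivity, fun c t hc => ?_⟩
  have h : ‖∫ y : ℝ, Complex.exp ((c + y * Complex.I) * t) • g (c + y * Complex.I)‖ ≤
      ∫ y : ℝ, Real.exp (c * t) * (K * (1 + y ^ 2)⁻¹) := by
    refine norm_integral_le_of_norm_le
      ((integrable_inv_one_add_sq.const_mul K).const_mul _) (.of_forall fun y => ?_)
    rw [norm_smul, Complex.norm_exp]
    have := hK (c + y * Complex.I) (by simpa using hc)
    simp only [pow_zero, one_mul, Complex.add_im, Complex.ofReal_im, Complex.mul_im,
      Complex.ofReal_re, Complex.I_im, mul_one, Complex.I_re, mul_zero, add_zero, zero_add] at this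
    simp only [Complex.mul_re, Complex.add_re, Complex.ofReal_re, Complex.I_re, mul_zero,
      Complex.ofReal_im, Complex.I_im, mul_one, sub_self, add_zero, sub_zero]
    gcongr
  rw [integral_const_mul] at h
  rw [inverseLaplace, norm_smul, Real.norm_of_nonneg (by positivity)]
  calc _ ≤ (2 * Real.pi)⁻¹ * (Real.exp (c * t) * ∫ y : ℝ, K * (1 + y ^ 2)⁻¹) := by gcongr
    _ = J * Real.exp (c * t) := by ring
    _ ≤ _ := by gcongr; linarith

theorem inverseLaplace_eq [CompleteSpace E] (hg : RapidDecayHalfPlane g a) {c d : ℝ} (hc : a < c)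
    (hd : a < d) (t : ℝ) : inverseLaplace g c t = inverseLaplace g d t := by
  wlog hcd : c ≤ d generalizing c d
  · exact (this hd hc (le_of_not_ge hcd)).symm
  obtain ⟨K, hK0, hK⟩ := hg.exists_pow_mul_norm_le 0
  rw [inverseLaplace, inverseLaplace]
  congr 1
  -- The maximum bounds `exp (z t)` on the strip for either sign of `t`.
  refine integral_vertical_line_eq (F := fun z => Complex.exp (z * t) • g z)
    (K := Real.exp (max (c * t) (d * t)) * K) hcd ?_ fun z hz => ?_
  · exact (by fun_prop : DifferentiableOn ℂ (fun z : ℂ => Complex.exp (z * t)) _).smul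
      (hg.differentiableOn.mono fun z hz => hc.trans_le hz.1)
  · have h := hK z (hc.trans_le hz.1)
    rw [pow_zero, one_mul] at h
    have h2 : z.re * t ≤ max (c * t) (d * t) := by
      rcases le_total 0 t with ht | ht
      · exact le_max_of_le_right (mul_le_mul_of_nonneg_right hz.2 ht)
      · exact le_max_of_le_left (mul_le_mul_of_nonpos_right hz.1 ht)
    rw [norm_smul, Complex.norm_exp, mul_assoc]
    gcongr
    simpa using h2

theorem norm_inverseLaplace_le_exp [CompleteSpace E] (hg : RapidDecayHalfPlane g a) {c : ℝ}
    (hc : a < c) : ∃ M : ℝ, 0 < M ∧ ∀ t, ‖inverseLaplace g c t‖ ≤ M * Real.exp (a * t) := by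
  obtain ⟨M, hM, h⟩ := hg.exists_norm_inverseLaplace_le
  refine ⟨M, hM, fun t => ?_⟩
  have hlim : Tendsto (fun d : ℝ => M * Real.exp (d * t)) (𝓝[>] a) (𝓝 (M * Real.exp (a * t))) :=
    ((by fun_prop : Continuous fun d : ℝ => M * Real.exp (d * t)).tendsto a).mono_left
      nhdsWithin_le_nhds
  refine ge_of_tendsto hlim ?_
  filter_upwards [self_mem_nhdsWithin] with d hd
  rw [hg.inverseLaplace_eq hc hd]
  exact h d t hd

theorem inverseLaplace_eq_zero [CompleteSpace E] (hg : RapidDecayHalfPlane g a) {c t : ℝ}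
    (hc : a < c) (ht : t < 0) : inverseLaplace g c t = 0 := by
  obtain ⟨M, hM, h⟩ := hg.exists_norm_inverseLaplace_le
  have hlim : Tendsto (fun d : ℝ => M * Real.exp (d * t)) atTop (𝓝 (M * 0)) :=
    (Real.tendsto_exp_atBot.comp (tendsto_id.atTop_mul_const_of_neg ht)).const_mul M
  rw [mul_zero] at hlim
  rw [← norm_le_zero_iff]
  refine ge_of_tendsto hlim ?_
  filter_upwards [eventually_gt_atTop a] with d hd
  rw [hg.inverseLaplace_eq hc hd]
  exact h d t hd

/-- Every derivative is continuous on `ℝ` and vanishes for `t < 0`, hence also in the limit at `0`.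
-/
theorem iteratedDeriv_inverseLaplace_zero [CompleteSpace E] (hg : RapidDecayHalfPlane g a) {c : ℝ}
    (hc : a < c) (j : ℕ) : iteratedDeriv j (inverseLaplace g c) 0 = 0 := by
  have hcont := (hg.contDiff_inverseLaplace hc).continuous_iteratedDeriv j
    (by exact_mod_cast le_top)
  have hzero : EqOn (iteratedDeriv j (inverseLaplace g c)) (iteratedDeriv j fun _ => 0) (Iio 0) :=
    EqOn.iteratedDeriv_of_isOpen (fun t ht => hg.inverseLaplace_eq_zero hc ht) isOpen_Iio j
  have hlim := (hcont.tendsto 0).mono_left (nhdsWithin_le_nhds (s := Iio 0))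
  refine tendsto_nhds_unique (hlim.congr' ?_) tendsto_const_nhds
  filter_upwards [self_mem_nhdsWithin] with t ht
  rw [hzero ht]
  simp

theorem integrableOn_exp_smul_inverseLaplace [CompleteSpace E] (hg : RapidDecayHalfPlane g a)
    {c : ℝ} (hc : a < c) {z : ℂ} (hz : a < z.re) :
    IntegrableOn (fun t : ℝ => Complex.exp (-z * t) • inverseLaplace g c t) (Ioi 0) := by
  obtain ⟨M, hM, h⟩ := hg.norm_inverseLaplace_le_exp hc
  have hexp : IntegrableOn (fun t : ℝ => M * Real.exp (-(z.re - a) * t)) (Ioi 0) :=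
    (integrableOn_exp_mul_Ioi (by linarith) 0).const_mul M
  refine hexp.mono' ?_ (.of_forall fun t => ?_)
  · have := (hg.contDiff_inverseLaplace hc).continuous
    exact (by fun_prop : Continuous fun t : ℝ =>
      Complex.exp (-z * t) • inverseLaplace g c t).aestronglyMeasurable
  · rw [norm_smul, Complex.norm_exp]
    calc _ ≤ Real.exp (-z * t).re * (M * Real.exp (a * t)) := by gcongr; exact h t
      _ = M * (Real.exp (-z * t).re * Real.exp (a * t)) := by ring
      _ = _ := by
        rw [← Real.exp_add]
        congr 2
        simp
        ring

theorem integral_exp_smul_inverseLaplace [CompleteSpace E] (hg : RapidDecayHalfPlane g a) {c : ℝ}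
    (hc : a < c) {z : ℂ} (hz : a < z.re) :
    ∫ t in Ioi (0 : ℝ), Complex.exp (-z * t) • inverseLaplace g c t = g z := by
  -- The line through `z` is used: there `exp (-Re z * t) • h t` is the inverse Fourier transform of
  -- `G`, and `z` corresponds to frequency `Im z / (2π)`.
  set G := fun v : ℝ => g (z.re + (2 * Real.pi * v : ℝ) * Complex.I) with hG
  have hinv : ∀ t : ℝ, FourierTransform.fourierInv G t =
      Complex.exp (-z.re * t) • inverseLaplace g c t := by
    intro t
    rw [hg.inverseLaplace_eq hc hz, inverseLaplace_eq_fourierInv, smul_smul, ← Complex.exp_add]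
    simp [hG]
  have hoff : ∀ (w : ℂ) (t : ℝ), t ∉ Ici (0 : ℝ) →
      Complex.exp (-w * t) • inverseLaplace g c t = 0 := fun w t ht => by
    rw [hg.inverseLaplace_eq_zero hc (not_le.1 ht), smul_zero]
  -- Vanishing is available only for `t < 0`, so the passage from `Ioi 0` to `ℝ` goes through `Ici
  -- 0`.
  have hint : Integrable (FourierTransform.fourierInv G) := by
    have h := hg.integrableOn_exp_smul_inverseLaplace hc (z := z.re) (by simpa using hz)
    rw [← integrableOn_Ici_iff_integrableOn_Ioi,
      integrableOn_iff_integrable_of_support_subset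
        (Function.support_subset_iff'.2 (hoff _))] at h
    exact h.congr (.of_forall fun t => (hinv t).symm)
  have hint' : Integrable (FourierTransform.fourier G) := by
    refine hint.comp_neg.congr (.of_forall fun t => ?_)
    simp [Real.fourierInv_eq_fourier_neg]
  have hmain := congrFun ((hg.continuous_line hz).fourier_fourierInv_eq
    (hg.integrable_line hz) hint') (z.im / (2 * Real.pi))
  rw [Real.fourier_real_eq_integral_exp_smul] at hmain
  rw [← integral_Ici_eq_integral_Ioi,
    setIntegral_eq_integral_of_forall_compl_eq_zero (hoff z)]
  have hpi : (2 * Real.pi) * (z.im / (2 * Real.pi)) = z.im := by field_simp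
  rw [hpi, Complex.re_add_im] at hmain
  rw [← hmain]
  congr 1 with t
  rw [hinv, smul_smul, ← Complex.exp_add]
  congr 2
  have h1 : -2 * Real.pi * t * (z.im / (2 * Real.pi)) = -z.im * t := by field_simp
  rw [h1]
  nth_rewrite 1 [← Complex.re_add_im z]
  push_cast
  ring

end RapidDecayHalfPlane

end InverseLaplace

/-! ### Application to the quotient by the symbols -/

/-- Dividing by the two symbols leaves a function that decays rapidly in the half-plane. -/
theorem rapidDecayHalfPlane_symbol_inv_smul {E : Type*} [NormedAddCommGroup E] [NormedSpace ℂ E]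
    {a : ℝ} {f : ℂ → E} (hf : AnalyticOnNhd ℂ f {z : ℂ | a < z.re})
    {p q : ℕ → ℂ} (hp : IsLocalOperator p) (hq : IsLocalOperator q)
    (hp0 : ∀ z : ℂ, a < z.re → symbol p z ≠ 0) (hq0 : ∀ z : ℂ, a < z.re → symbol q z ≠ 0)
    {C : ℝ} (hC : 0 ≤ C) (hfP : ∀ z : ℂ, a < z.re → ‖f z‖ ≤ C * ‖symbol p z‖)
    (hqlow : HasExpLowerBound q a) :
    RapidDecayHalfPlane (fun z => (symbol p z * symbol q z)⁻¹ • f z) a := by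
  obtain ⟨C₁, hC₁, A, hA, r, hr, hr0, -, hlog, hlow⟩ := hqlow
  refine ⟨?_, fun n => ?_⟩
  · refine DifferentiableOn.smul ?_ hf.differentiableOn
    exact (hp.differentiable_symbol.mul hq.differentiable_symbol).differentiableOn.inv
      fun z hz => mul_ne_zero (hp0 z hz) (hq0 z hz)
  -- Monotonicity and `r 0 = 1` give `r ≥ 1` on `[0, ∞)`.
  · have hψ0 : ∀ s : ℝ, 0 ≤ s → 0 ≤ s / r (s + 1) := fun s hs => by
      have := hr self_mem_Ici (show s + 1 ∈ Ici (0 : ℝ) from by simp; linarith) (by linarith)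
      exact div_nonneg hs (by linarith)
    obtain ⟨K, hK0, hK⟩ := exists_one_add_pow_mul_exp_neg_le hA hlog hψ0 n
    refine ⟨C / C₁ * K, by positivity, fun z hz => ?_⟩
    have hp' := norm_pos_iff.2 (hp0 z hz)
    have hq' := norm_pos_iff.2 (hq0 z hz)
    have hz' := hlow z hz
    rw [mul_div_assoc] at hz'
    have hqinv : ‖symbol q z‖⁻¹ ≤ C₁⁻¹ * Real.exp (-(A * (‖z‖ / r (‖z‖ + 1)))) := by
      rw [Real.exp_neg, ← mul_inv]
      exact inv_anti₀ (by positivity) hz'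
    rw [norm_smul, norm_inv, norm_mul]
    calc (1 + ‖z‖) ^ n * ((‖symbol p z‖ * ‖symbol q z‖)⁻¹ * ‖f z‖)
        ≤ (1 + ‖z‖) ^ n * ((‖symbol p z‖ * ‖symbol q z‖)⁻¹ * (C * ‖symbol p z‖)) := by
          gcongr; exact hfP z hz
      _ = C * (1 + ‖z‖) ^ n * ‖symbol q z‖⁻¹ := by field_simp
      _ ≤ C * (1 + ‖z‖) ^ n * (C₁⁻¹ * Real.exp (-(A * (‖z‖ / r (‖z‖ + 1))))) := by gcongr
      _ = C / C₁ * ((1 + ‖z‖) ^ n * Real.exp (-(A * (‖z‖ / r (‖z‖ + 1))))) := by ring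
      _ ≤ _ := by gcongr; exact hK ‖z‖ (norm_nonneg z)

theorem theorem2p1 {E : Type*} [NormedAddCommGroup E] [NormedSpace ℂ E] [CompleteSpace E]
    (a : ℝ) (f : ℂ → E) (hf : AnalyticOnNhd ℂ f {z : ℂ | a < z.re})
    (p q : ℕ → ℂ) (hp : IsLocalOperator p) (hq : IsLocalOperator q)
    (hp0 : ∀ z : ℂ, a < z.re → 0 < ‖symbol p z‖)
    (C : ℝ) (hC : 0 < C) (hfP : ∀ z : ℂ, a < z.re → ‖f z‖ ≤ C * ‖symbol p z‖)
    (hqlow : HasExpLowerBound q a) :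
    ∃ M : ℝ, 0 < M ∧ ∃ h : ℝ → E,
      ContDiffOn ℝ ∞ h (Ici 0) ∧
      (∀ j : ℕ, iteratedDerivWithin j h (Ici 0) 0 = 0) ∧
      (∀ t : ℝ, 0 ≤ t → ‖h t‖ ≤ M * Real.exp (a * t)) ∧
      ∀ z : ℂ, a < z.re →
        IntegrableOn (fun t : ℝ => Complex.exp (-z * (t : ℂ)) • h t) (Ioi 0) ∧
        f z = (symbol p z * symbol q z) •
          ∫ t in Ioi (0 : ℝ), Complex.exp (-z * (t : ℂ)) • h t := by
  have hp0' : ∀ z : ℂ, a < z.re → symbol p z ≠ 0 := fun z hz => norm_pos_iff.1 (hp0 z hz)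
  have hq0 : ∀ z : ℂ, a < z.re → symbol q z ≠ 0 := by
    obtain ⟨C₁, hC₁, A, -, r, -, -, -, -, hlow⟩ := hqlow
    exact fun z hz => norm_pos_iff.1 (lt_of_lt_of_le (by positivity) (hlow z hz))
  have hg := rapidDecayHalfPlane_symbol_inv_smul hf hp hq hp0' hq0 hC.le hfP hqlow
  have hc : a < a + 1 := by linarith
  obtain ⟨M, hM, hbound⟩ := hg.norm_inverseLaplace_le_exp hc
  have hsmooth := hg.contDiff_inverseLaplace hc
  refine ⟨M, hM, _, hsmooth.contDiffOn, fun j => ?_, fun t _ => hbound t, fun z hz =>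
    ⟨hg.integrableOn_exp_smul_inverseLaplace hc hz, ?_⟩⟩
  · rw [iteratedDerivWithin_eq_iteratedDeriv (uniqueDiffOn_Ici 0)
      (hsmooth.contDiffAt.of_le (by exact_mod_cast le_top)) self_mem_Ici]
    exact hg.iteratedDeriv_inverseLaplace_zero hc j
  · rw [hg.integral_exp_smul_inverseLaplace hc hz, smul_smul,
      mul_inv_cancel₀ (mul_ne_zero (hp0' z hz) (hq0 z hz)), one_smul]
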